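/- Let $\varepsilon_0>0$, let $B$ be the open ball in $\mathbb R^3$ with centre $c$ and radius $r>0$, and let $S=\partial B$. Let $\varphi_0$ be a real function (the potential of an external electric field) that is harmonic in $B$; no axial symmetry is assumed. Let $\sigma$ be the charge density induced by $\varphi_0$ on the surface $S$ of the grounded conducting ball, that is, $\sigma$ is integrable on $S$ and the total potential $\varphi_0+u$, where $$u(x)=\frac1{4\pi\varepsilon_0}\int_S\frac{\sigma(y)}{|x-y|}\,dS(y),$$ vanishes either at every point of $B$, or at almost every point of $S$ with $\varphi_0$ being continuous on $B\cup S$. Let $Q=\int_S\sigma\,dS$ be the full charge and $\mathcal D=\int_S (y-c)\,\sigma(y)\,dS(y)$ the (vector) dipole moment of the ball. For a unit vector $e$ write $-\varphi_0(c+se)=b_1+b_2(e)\,s+o(s)$ as $s\to0$, so that $b_1=-\varphi_0(c)$ and $b_2(e)=-\partial_e\varphi_0(c)$. Then $$Q=4\pi\varepsilon_0\,r\,b_1,\qquad e\cdot\mathcal D=4\pi\varepsilon_0\,r^3\,b_2(e)\quad\text{for every unit vector } e,$$ that is, $\mathcal D=-4\pi\varepsilon_0\,r^3\,\nabla\varphi_0(c)$.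 -/

import Mathlib

open MeasureTheory Metric

noncomputable section

/-- Three-dimensional Euclidean space. -/
abbrev E3 : Type := EuclideanSpace ℝ (Fin 3)

/-- The surface integral `∫ f dS` over the sphere of radius `r` centred at `c`: the integral over the
unit sphere with its surface measure (of total mass `4π`), pulled back along `ω ↦ c + r ω`, whose
area factor is `r ^ 2`. -/
def sphereIntegral {F : Type*} [NormedAddCommGroup F] [NormedSpace ℝ F]
    (c : E3) (r : ℝ) (f : E3 → F) : F :=
  r ^ 2 • ∫ ω : sphere (0 : E3) 1, f (c + r • (ω : E3)) ∂(volume : Measure E3).toSphere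

/-- The potential `u(x) = 1 / (4 π ε₀) ∫ σ(y) / |x - y| dS(y)` generated at `x` by the charges
of density `σ` on the sphere of radius `r` centred at `c`. -/
def surfacePotential (ε₀ : ℝ) (c : E3) (r : ℝ) (σ : E3 → ℝ) (x : E3) : ℝ :=
  1 / (4 * Real.pi * ε₀) * sphereIntegral c r (fun y => σ y / ‖x - y‖)

/-- The total potential `φ₀ + u`: external potential plus the potential of the surface charges. -/
def totalPotential (ε₀ : ℝ) (c : E3) (r : ℝ) (φ₀ σ : E3 → ℝ) (x : E3) : ℝ :=
  φ₀ x + surfacePotential ε₀ c r σ x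

/-- `σ` is a surface charge density induced by the external potential `φ₀` on the grounded
conducting ball of radius `r` centred at `c`: it is integrable over the sphere, and it shields the
external field, in either of two senses.
* Interior: the total potential is zero at every point of the open ball.
* Surface: `φ₀` is continuous up to the sphere and the total potential is zero at (almost) every
  point of the sphere. -/
def IsInducedDensity (ε₀ : ℝ) (c : E3) (r : ℝ) (φ₀ σ : E3 → ℝ) : Prop :=
  Integrable (fun ω : sphere (0 : E3) 1 => σ (c + r • (ω : E3))) (volume : Measure E3).toSphere ∧
  ((∀ x ∈ ball c r, totalPotential ε₀ c r φ₀ σ x = 0) ∨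
   (ContinuousOn φ₀ (closedBall c r) ∧
    ∀ᵐ ω : sphere (0 : E3) 1 ∂(volume : Measure E3).toSphere,
      totalPotential ε₀ c r φ₀ σ (c + r • (ω : E3)) = 0))

/-- The full charge `Q = ∫ σ dS`. -/
def fullCharge (c : E3) (r : ℝ) (σ : E3 → ℝ) : ℝ :=
  sphereIntegral c r σ

/-- The dipole moment `D = ∫ (y - c) σ(y) dS(y)` about the centre, a vector; its component along an
axis through `c` is the integral of `z σ`, where `z` is the coordinate on that axis. -/
def dipoleMoment (c : E3) (r : ℝ) (σ : E3 → ℝ) : E3 :=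
  sphereIntegral c r (fun y => σ y • (y - c))

/-- The coefficient `b₁` of `-φ₀(c + s e) = b₁ + b₂ s + ⋯` (the same for all axes `e`). -/
def axisCoeff₁ (φ₀ : E3 → ℝ) (c : E3) : ℝ :=
  -φ₀ c

/-- The coefficient `b₂` of `-φ₀(c + s e) = b₁ + b₂ s + ⋯` on the axis through `c` along `e`. -/
def axisCoeff₂ (φ₀ : E3 → ℝ) (c e : E3) : ℝ :=
  -deriv (fun s : ℝ => φ₀ (c + s • e)) 0

end

/-! Only the moments of `σ` of degree 0 and 1 over the sphere are needed
(`IsInducedDensity.moments`), and each form of shielding gives them.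

If the total potential vanishes in the ball, look at the centre. There the kernel 1/|x - y| equals
1/r for every y on the sphere, and its gradient in x is (y - c)/r³. So the value of the potential of
`σ` at the centre gives the charge, and its gradient there gives the dipole moment. These must
cancel `φ₀ c` and its gradient.

If it vanishes almost everywhere on the sphere, integrate that identity against the weights 1 and
ω·v. On the `φ₀` side, the mean value property and its first-order analogue give 4π φ₀(c) and (4π/3)
r ∇φ₀(c)·v. On the other side, Fubini moves the weight onto the kernel. Constants and linear
functions are eigenfunctions of the single-layer operator on the unit sphere, with eigenvalues 4π
and 4π/3, so the moments of `σ` remain.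

Both sides rest on `integral_sphere_eq` and `integral_sphere_inner_mul_eq`, applied to `φ₀` and to
the kernel with its pole y on the sphere. They hold on smaller spheres first; the boundary is
reached by continuity of `φ₀`, and by Fatou and dominated convergence for the kernel. -/

/-! ### Flux of divergence-free fields through centred spheres. -/

theorem integral_fderiv_apply_eq_zero {F : E3 → ℝ} (hF : ContDiff ℝ 1 F)
    (hc : HasCompactSupport F) (v : E3) : ∫ x, fderiv ℝ F x v = 0 := by
  have hd : Continuous fun x => fderiv ℝ F x v :=
    (hF.continuous_fderiv one_ne_zero).clm_apply continuous_const
  have hi : Integrable (fun x => fderiv ℝ F x v) :=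
    hd.integrable_of_hasCompactSupport (hc.fderiv_apply ℝ v)
  have := integral_mul_fderiv_eq_neg_fderiv_mul_of_integrable (μ := (volume : Measure E3))
    (f := fun _ => (1 : ℝ)) (g := F) (v := v) (by simp) (by simpa using hi)
    (by simpa using hF.continuous.integrable_of_hasCompactSupport hc)
    (fun x _ => by fun_prop) (fun x _ => (hF.differentiable one_ne_zero) x)
  simpa using this

/-- Integration in polar coordinates. -/
theorem integral_eq_integral_Ioi_sphere {h : E3 → ℝ} (hh : Integrable h) :
    ∫ x, h x = ∫ ρ in Set.Ioi (0 : ℝ), ρ ^ 2 *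
      ∫ ω : sphere (0 : E3) 1, h (ρ • (ω : E3)) ∂(volume : Measure E3).toSphere := by
  have hmp := (volume : Measure E3).measurePreserving_homeomorphUnitSphereProd
  have hemb := (homeomorphUnitSphereProd E3).measurableEmbedding
  set k : sphere (0 : E3) 1 × Set.Ioi (0 : ℝ) → ℝ := fun p => h ((p.2 : ℝ) • (p.1 : E3)) with hk
  have hcomp : ∀ x : ({(0)}ᶜ : Set E3), k (homeomorphUnitSphereProd E3 x) = h x := by
    intro x
    have hx : ‖(x : E3)‖ ≠ 0 := norm_ne_zero_iff.2 x.2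
    simp [hk, smul_smul, hx]
  have hki : Integrable k ((volume : Measure E3).toSphere.prod
      (.volumeIoiPow (Module.finrank ℝ E3 - 1))) := by
    rw [← hmp.integrable_comp_emb hemb]
    have : (k ∘ homeomorphUnitSphereProd E3) = h ∘ Subtype.val := funext hcomp
    rw [this, ← integrableOn_iff_comap_subtypeVal (by measurability)]
    exact hh.integrableOn
  calc
    ∫ x, h x = ∫ x : ({(0)}ᶜ : Set E3), h x ∂((volume : Measure E3).comap (↑)) := by
      rw [integral_subtype_comap (measurableSet_singleton _).compl h, restrict_compl_singleton]
    _ = ∫ p, k p ∂((volume : Measure E3).toSphere.prod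
          (.volumeIoiPow (Module.finrank ℝ E3 - 1))) := by
      rw [← hmp.integral_comp hemb]
      exact integral_congr_ae (.of_forall fun x => (hcomp x).symm)
    _ = ∫ ρ : Set.Ioi (0 : ℝ), ∫ ω : sphere (0 : E3) 1, h ((ρ : ℝ) • (ω : E3))
          ∂(volume : Measure E3).toSphere ∂(Measure.volumeIoiPow (Module.finrank ℝ E3 - 1)) :=
      integral_prod_symm _ hki
    _ = _ := by
      simp only [Measure.volumeIoiPow, ENNReal.ofReal]
      rw [integral_withDensity_eq_integral_smul]
      · rw [integral_subtype_comap measurableSet_Ioi fun a : ℝ =>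
          Real.toNNReal (a ^ (Module.finrank ℝ E3 - 1)) •
            ∫ ω : sphere (0 : E3) 1, h (a • (ω : E3)) ∂(volume : Measure E3).toSphere]
        refine setIntegral_congr_fun measurableSet_Ioi fun x hx => ?_
        simp only [finrank_euclideanSpace, Fintype.card_fin]
        rw [NNReal.smul_def, Real.coe_toNNReal _ (pow_nonneg (le_of_lt hx) _)]
        simp
      · exact (measurable_subtype_coe.pow_const _).real_toNNReal

/-- The divergence of a vector field. -/
noncomputable def fieldDiv (F : E3 → E3) (x : E3) : ℝ :=
  ∑ i, (fderiv ℝ F x (EuclideanSpace.single i 1)) i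

/-- The field g(|x|) x is -1/2 times the gradient of a radial function χ vanishing for |x| ≥ a.
Since div F = 0, the integrand is -1/2 times the divergence of χF, which is compactly supported in
the ball. This is the flux statement smeared over radii, so the divergence theorem on a ball is not
needed. -/
theorem integral_radial_mul_inner_eq_zero {R a : ℝ} (haR : a < R) (ha : 0 ≤ a) {F : E3 → E3}
    (hF : ContDiffOn ℝ 1 F (ball 0 R)) (hdiv : ∀ x ∈ ball (0 : E3) R, fieldDiv F x = 0)
    {g : ℝ → ℝ} (hg : Continuous g) (hga : ∀ s, a ≤ s → g s = 0) :
    ∫ x : E3, g ‖x‖ * inner ℝ x (F x) = 0 := by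
  -- Taking the primitive in the variable |x|² rather than |x| keeps χ continuously differentiable
  -- at the origin.
  set q : ℝ → ℝ := fun s => g (Real.sqrt s) with hq
  have hqc : Continuous q := by fun_prop
  set η : ℝ → ℝ := fun t => ∫ s in t..(a ^ 2), q s with hη
  have hηd : ∀ t, HasDerivAt η (-q t) t := fun t =>
    intervalIntegral.integral_hasDerivAt_left (hqc.intervalIntegrable _ _)
      (hqc.stronglyMeasurableAtFilter _ _) hqc.continuousAt
  have hηC : ContDiff ℝ 1 η := by
    rw [contDiff_one_iff_deriv]
    refine ⟨fun t => (hηd t).differentiableAt, ?_⟩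
    have : deriv η = fun t => -q t := funext fun t => (hηd t).deriv
    rw [this]; fun_prop
  have hη0 : ∀ t, a ^ 2 ≤ t → η t = 0 := by
    intro t ht
    have : Set.EqOn q (fun _ => 0) (Set.uIcc t (a ^ 2)) := by
      intro s hs
      rw [Set.uIcc_of_ge ht] at hs
      exact hga _ (Real.le_sqrt_of_sq_le hs.1)
    simp only [hη]
    rw [intervalIntegral.integral_congr this]; simp
  set χ : E3 → ℝ := fun x => η (‖x‖ ^ 2) with hχ
  have hχC : ContDiff ℝ 1 χ := hηC.comp (contDiff_norm_sq ℝ)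
  have hχ0 : ∀ x, a ≤ ‖x‖ → χ x = 0 := fun x hx => hη0 _ (by gcongr)
  have hχd : ∀ x v, fderiv ℝ χ x v = -(2 * g ‖x‖ * inner ℝ x v) := by
    intro x v
    have h1 : HasFDerivAt (fun y : E3 => ‖y‖ ^ 2) (2 • innerSL ℝ x) x :=
      (hasStrictFDerivAt_norm_sq x).hasFDerivAt
    have h2 := (hηd (‖x‖ ^ 2)).comp_hasFDerivAt x h1
    have h3 : fderiv ℝ χ x = _ := h2.fderiv
    rw [h3]
    simp [hq]; ring
  set H : Fin 3 → E3 → ℝ := fun i x => χ x * F x i with hH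
  have hout : ∀ x, x ∉ ball (0 : E3) R → χ =ᶠ[nhds x] fun _ => 0 := by
    intro x hx
    have : a < ‖x‖ := haR.trans_le (by simpa using hx)
    filter_upwards [(continuous_norm.isOpen_preimage _ isOpen_Ioi).mem_nhds this] with y hy
    exact hχ0 y (le_of_lt hy)
  have hHC : ∀ i, ContDiff ℝ 1 (H i) := by
    intro i
    rw [contDiff_iff_contDiffAt]
    intro x
    by_cases hx : x ∈ ball (0 : E3) R
    · have hFx : ContDiffAt ℝ 1 F x := (hF x hx).contDiffAt (isOpen_ball.mem_nhds hx)
      have hFi : ContDiffAt ℝ 1 (fun y => F y i) x := by fun_prop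
      exact hχC.contDiffAt.mul hFi
    · refine (contDiffAt_const (c := (0 : ℝ))).congr_of_eventuallyEq ?_
      filter_upwards [hout x hx] with y hy
      simp [hH, hy]
  have hHs : ∀ i, HasCompactSupport (H i) := by
    intro i
    refine HasCompactSupport.intro (isCompact_closedBall (0 : E3) a) fun x hx => ?_
    have : a ≤ ‖x‖ := by simpa using (le_of_lt (by simpa using hx : a < ‖x‖))
    simp [hH, hχ0 x this]
  have hsum : ∀ x, ∑ i, fderiv ℝ (H i) x (EuclideanSpace.single i 1) =
      -2 * (g ‖x‖ * inner ℝ x (F x)) := by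
    intro x
    by_cases hx : x ∈ ball (0 : E3) R
    · have hFx : DifferentiableAt ℝ F x :=
        ((hF x hx).contDiffAt (isOpen_ball.mem_nhds hx)).differentiableAt one_ne_zero
      have hi : ∀ i v, fderiv ℝ (H i) x v = χ x * (fderiv ℝ F x v) i +
          F x i * -(2 * g ‖x‖ * inner ℝ x v) := by
        intro i v
        have h1 : HasFDerivAt (fun y => F y i)
            ((EuclideanSpace.proj i).comp (fderiv ℝ F x)) x :=
          (EuclideanSpace.proj (𝕜 := ℝ) i).hasFDerivAt.comp x hFx.hasFDerivAt
        have h2 := ((hχC.differentiable one_ne_zero) x).hasFDerivAt.mul h1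
        have h3 : fderiv ℝ (H i) x = _ := h2.fderiv
        rw [h3]
        simp [hχd]
      have hd := hdiv x hx
      simp only [fieldDiv] at hd
      simp only [hi, Finset.sum_add_distrib, ← Finset.mul_sum, hd]
      simp only [PiLp.inner_apply, Fin.sum_univ_three, EuclideanSpace.single]
      simp
      ring
    · have hg0 : g ‖x‖ = 0 := hga _ (haR.le.trans (by simpa using hx))
      rw [hg0]
      have : ∀ i, fderiv ℝ (H i) x = 0 := by
        intro i
        have : H i =ᶠ[nhds x] fun _ => 0 := by
          filter_upwards [hout x hx] with y hy
          simp [hH, hy]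
        rw [this.fderiv_eq]; simp
      simp [this]
  have h0 : ∫ x, ∑ i, fderiv ℝ (H i) x (EuclideanSpace.single i 1) = 0 := by
    rw [integral_finsetSum]
    · exact Finset.sum_eq_zero fun i _ => integral_fderiv_apply_eq_zero (hHC i) (hHs i) _
    · intro i _
      exact (((hHC i).continuous_fderiv one_ne_zero).clm_apply
        continuous_const).integrable_of_hasCompactSupport ((hHs i).fderiv_apply ℝ _)
  simp only [hsum] at h0
  rw [integral_const_mul] at h0
  linarith

/-- A divergence-free field has no flux through spheres. -/
theorem integral_sphere_inner_eq_zero {R ρ : ℝ} {F : E3 → E3}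
    (hF : ContDiffOn ℝ 1 F (ball 0 R)) (hdiv : ∀ x ∈ ball (0 : E3) R, fieldDiv F x = 0)
    (hρ : 0 < ρ) (hρR : ρ < R) :
    ∫ ω : sphere (0 : E3) 1, inner ℝ (ω : E3) (F (ρ • (ω : E3)))
      ∂(volume : Measure E3).toSphere = 0 := by
  set N : ℝ → ℝ := fun ρ => ∫ ω : sphere (0 : E3) 1, inner ℝ (ω : E3) (F (ρ • (ω : E3)))
      ∂(volume : Measure E3).toSphere with hN
  have hNc : ContinuousOn N (Set.Ioo 0 R) := by
    refine continuousOn_integral_of_compact_support isCompact_univ ?_ (by simp)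
    have h1 : ContinuousOn (fun p : ℝ × sphere (0 : E3) 1 => F (p.1 • (p.2 : E3)))
        (Set.Ioo 0 R ×ˢ Set.univ) := by
      refine hF.continuousOn.comp (by fun_prop) ?_
      rintro ⟨s, ω⟩ ⟨hs, -⟩
      simp [norm_smul, abs_of_pos hs.1, hs.2]
    exact ContinuousOn.inner (by fun_prop) h1
  set f : ℝ → ℝ := fun ρ => ρ ^ 2 * (ρ * N ρ) with hf
  have hfc : ContinuousOn f (Set.Ioo 0 R) := by fun_prop
  -- In polar coordinates the smeared identity says that `f` is orthogonal to every test function on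
  -- (0, R). Hence it vanishes almost everywhere, and then everywhere by continuity.
  have hae : ∀ᵐ ρ, ρ ∈ Set.Ioo 0 R → f ρ = 0 := by
    refine isOpen_Ioo.ae_eq_zero_of_integral_contDiff_smul_eq_zero
      (hfc.locallyIntegrableOn measurableSet_Ioo) ?_
    intro g hg hgc hgs
    obtain ⟨a, ha0, haR, hga⟩ : ∃ a, 0 ≤ a ∧ a < R ∧ ∀ s, a ≤ s → g s = 0 := by
      rcases (tsupport g).eq_empty_or_nonempty with he | hne
      · refine ⟨0, le_rfl, hρ.trans hρR, fun s _ => ?_⟩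
        exact image_eq_zero_of_notMem_tsupport (by simp [he])
      · obtain ⟨b, hb, hbm⟩ := hgc.isCompact.exists_isGreatest hne
        refine ⟨(b + R) / 2, ?_, ?_, fun s hs => ?_⟩
        · linarith [(hgs hb).1, (hgs hb).2]
        · linarith [(hgs hb).2]
        · refine image_eq_zero_of_notMem_tsupport fun h => ?_
          linarith [hbm h, (hgs hb).2]
    have h1 := integral_radial_mul_inner_eq_zero haR ha0 hF hdiv hg.continuous hga
    have hg0 : ∀ s, s ∉ Set.Ioo 0 R → g s = 0 := fun s hs =>
      image_eq_zero_of_notMem_tsupport fun h => hs (hgs h)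
    have hcont : Continuous fun x : E3 => g ‖x‖ * inner ℝ x (F x) := by
      rw [continuous_iff_continuousAt]
      intro x
      by_cases hx : x ∈ ball (0 : E3) R
      · have hFx := (hF.continuousOn x hx).continuousAt (isOpen_ball.mem_nhds hx)
        have := hg.continuous
        exact (by fun_prop : ContinuousAt (fun x : E3 => g ‖x‖) x).mul
          (continuousAt_id.inner hFx)
      · have : a < ‖x‖ := haR.trans_le (by simpa using hx)
        refine (continuousAt_const (y := (0 : ℝ))).congr ?_
        filter_upwards [(continuous_norm.isOpen_preimage _ isOpen_Ioi).mem_nhds this] with y hy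
        simp [hga _ (le_of_lt hy)]
    have hint : Integrable fun x : E3 => g ‖x‖ * inner ℝ x (F x) := by
      refine hcont.integrable_of_hasCompactSupport
        (HasCompactSupport.intro (isCompact_closedBall (0 : E3) a) fun x hx => ?_)
      have : a ≤ ‖x‖ := (by simpa using hx : a < ‖x‖).le
      simp [hga _ this]
    rw [integral_eq_integral_Ioi_sphere hint] at h1
    rw [← h1, ← setIntegral_eq_integral_of_forall_compl_eq_zero (s := Set.Ioi 0)]
    · refine setIntegral_congr_fun measurableSet_Ioi fun s hs => ?_
      have hs' : (0 : ℝ) < s := hs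
      simp only [hf, hN, smul_eq_mul]
      rw [← integral_const_mul s, mul_left_comm, ← integral_const_mul (g s)]
      congr 1
      refine integral_congr_ae (.of_forall fun ω => ?_)
      simp [norm_smul, abs_of_pos hs', inner_smul_left]
    · intro s hs
      rw [hg0 s fun h => hs h.1, zero_smul]
  have heq : Set.EqOn f (fun _ => 0) (Set.Ioo 0 R) := by
    refine Measure.eqOn_open_of_ae_eq (μ := volume) ?_ isOpen_Ioo hfc continuousOn_const
    rw [Filter.EventuallyEq, ae_restrict_iff' measurableSet_Ioo]
    exact hae
  have := heq ⟨hρ, hρR⟩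
  simpa [hf, hρ.ne'] using this

/-! ### Mean values of harmonic functions against constant and linear weights. -/

theorem integrable_sphere_of_continuous {V : Type*} [NormedAddCommGroup V]
    {h : sphere (0 : E3) 1 → V} (hh : Continuous h) :
    Integrable h (volume : Measure E3).toSphere :=
  hh.integrable_of_hasCompactSupport (HasCompactSupport.of_compactSpace h)

theorem smul_sphere_mem_ball {R s : ℝ} (hs : |s| < R) (ω : sphere (0 : E3) 1) :
    s • (ω : E3) ∈ ball (0 : E3) R := by
  simpa [norm_smul] using hs

theorem continuous_comp_smul_sphere {V : Type*} [TopologicalSpace V] {R s : ℝ} {f : E3 → V}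
    (hf : ContinuousOn f (ball 0 R)) (hs : |s| < R) :
    Continuous fun ω : sphere (0 : E3) 1 => f (s • (ω : E3)) :=
  hf.comp_continuous (by fun_prop) fun ω => smul_sphere_mem_ball hs ω

theorem hasDerivAt_integral_sphere {R ρ : ℝ} {f : E3 → ℝ} {G : E3 → E3}
    (hfG : ∀ x ∈ ball (0 : E3) R, HasGradientAt f (G x) x) (hG : ContinuousOn G (ball 0 R))
    {w : sphere (0 : E3) 1 → ℝ} (hw : Continuous w) (hρ : |ρ| < R) :
    HasDerivAt (fun s : ℝ => ∫ ω : sphere (0 : E3) 1, w ω * f (s • (ω : E3))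
        ∂(volume : Measure E3).toSphere)
      (∫ ω : sphere (0 : E3) 1, w ω * inner ℝ (ω : E3) (G (ρ • (ω : E3)))
        ∂(volume : Measure E3).toSphere) ρ := by
  have hf : ContinuousOn f (ball 0 R) := fun x hx =>
    (hfG x hx).differentiableAt.continuousAt.continuousWithinAt
  obtain ⟨R', hρR', hR'⟩ := exists_between hρ
  have hsub : closedBall (0 : E3) R' ⊆ ball 0 R := closedBall_subset_ball hR'
  obtain ⟨C, hC⟩ := (isCompact_closedBall (0 : E3) R').exists_bound_of_continuousOn (hG.mono hsub)
  have hopen : IsOpen {s : ℝ | |s| < R'} := isOpen_lt continuous_abs continuous_const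
  refine (hasDerivAt_integral_of_dominated_loc_of_deriv_le
    (bound := fun ω => ‖w ω‖ * C)
    (F' := fun s (ω : sphere (0 : E3) 1) => w ω * inner ℝ (ω : E3) (G (s • (ω : E3))))
    (hopen.mem_nhds hρR') ?_ ?_ ?_ ?_ ?_ ?_).2
  · filter_upwards [hopen.mem_nhds hρR'] with s hs
    exact (hw.mul (continuous_comp_smul_sphere hf (lt_trans hs hR'))).aestronglyMeasurable
  · exact integrable_sphere_of_continuous (hw.mul (continuous_comp_smul_sphere hf hρ))
  · have := continuous_comp_smul_sphere hG hρ
    exact (hw.mul (continuous_subtype_val.inner this)).aestronglyMeasurable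
  · refine .of_forall fun ω s hs => ?_
    have hs' : |s| < R' := hs
    rw [norm_mul]
    gcongr
    refine (norm_inner_le_norm _ _).trans ?_
    have := hC (s • (ω : E3)) (ball_subset_closedBall (smul_sphere_mem_ball hs' ω))
    simpa using this
  · exact integrable_sphere_of_continuous (by fun_prop)
  · refine .of_forall fun ω s hs => ?_
    have hs' : |s| < R' := hs
    have h1 := (hfG _ (smul_sphere_mem_ball (hs'.trans hR') ω)).hasFDerivAt
    have h2 : HasDerivAt (fun s : ℝ => s • (ω : E3)) (ω : E3) s := by
      simpa using (hasDerivAt_id s).smul_const (ω : E3)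
    have h3 := (h1.comp_hasDerivAt s h2).const_mul (w ω)
    simpa [real_inner_comm] using h3

theorem toSphere_real_univ : (volume : Measure E3).toSphere.real Set.univ = 4 * Real.pi := by
  have h : (volume : Measure E3).real (ball 0 1) = Real.pi * 4 / 3 := by
    rw [measureReal_def, EuclideanSpace.volume_ball_fin_three]
    simp
    positivity
  rw [Measure.toSphere_real_apply_univ, h]
  simp; ring

/-- The derivative of the spherical mean in the radius is a flux of the divergence-free gradient,
hence zero. -/
theorem integral_sphere_eq {R s : ℝ} {f : E3 → ℝ} {G : E3 → E3}
    (hfG : ∀ x ∈ ball (0 : E3) R, HasGradientAt f (G x) x)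
    (hG : ContDiffOn ℝ 1 G (ball 0 R)) (hdiv : ∀ x ∈ ball (0 : E3) R, fieldDiv G x = 0)
    (hs : 0 ≤ s) (hsR : s < R) :
    ∫ ω : sphere (0 : E3) 1, f (s • (ω : E3)) ∂(volume : Measure E3).toSphere
      = 4 * Real.pi * f 0 := by
  set M : ℝ → ℝ := fun s => ∫ ω : sphere (0 : E3) 1, f (s • (ω : E3))
    ∂(volume : Measure E3).toSphere with hM
  have hd : ∀ ρ, |ρ| < R → HasDerivAt M (∫ ω : sphere (0 : E3) 1,
      inner ℝ (ω : E3) (G (ρ • (ω : E3))) ∂(volume : Measure E3).toSphere) ρ := fun ρ hρ => by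
    simpa using hasDerivAt_integral_sphere hfG hG.continuousOn (w := fun _ => 1)
      continuous_const hρ
  have h0 : M 0 = 4 * Real.pi * f 0 := by
    simp only [hM, zero_smul, integral_const, toSphere_real_univ, smul_eq_mul]
  rw [← h0]
  have habs : ∀ t ∈ Set.Icc 0 s, |t| < R := fun t ht => by
    rw [abs_of_nonneg ht.1]; exact ht.2.trans_lt hsR
  refine constant_of_has_deriv_right_zero (a := 0) (b := s) (f := M)
    (fun t ht => (hd t (habs t ht)).continuousAt.continuousWithinAt) (fun t ht => ?_) s
    ⟨hs, le_rfl⟩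
  have h1 := hd t (habs t ⟨ht.1, ht.2.le⟩)
  rcases ht.1.eq_or_lt with rfl | hpos
  -- At radius 0 the integrand is ω·G(0), which is the flux of a constant field through the unit
  -- sphere.
  · have : ∫ ω : sphere (0 : E3) 1, inner ℝ (ω : E3) (G 0)
        ∂(volume : Measure E3).toSphere = 0 :=
      integral_sphere_inner_eq_zero (R := 2) (ρ := 1) (F := fun _ => G 0) contDiffOn_const
        (by simp [fieldDiv]) one_pos one_lt_two
    simp only [zero_smul, this] at h1
    exact h1.hasDerivWithinAt
  · rw [integral_sphere_inner_eq_zero hG hdiv hpos (ht.2.trans hsR)] at h1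
    exact h1.hasDerivWithinAt

/-- The field (x·u)v - (u·v/3)x has divergence u·v - 3(u·v/3) = 0, and its vanishing flux through
the unit sphere is the identity. -/
theorem integral_sphere_inner_mul_inner (u v : E3) :
    ∫ ω : sphere (0 : E3) 1, inner ℝ (ω : E3) u * inner ℝ (ω : E3) v
      ∂(volume : Measure E3).toSphere = 4 * Real.pi / 3 * inner ℝ u v := by
  set F : E3 → E3 := fun x => inner ℝ x u • v - (inner ℝ u v / 3) • x with hF
  have hdiv : ∀ x, fieldDiv F x = 0 := by
    intro x
    have h1 : HasFDerivAt F ((innerSL ℝ u).smulRight v -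
        (inner ℝ u v / 3 : ℝ) • ContinuousLinearMap.id ℝ E3) x := by
      have h2 := (((innerSL ℝ u).hasFDerivAt (x := x)).smul_const v).sub
        ((hasFDerivAt_id (𝕜 := ℝ) x).const_smul (inner ℝ u v / 3 : ℝ))
      refine h2.congr_of_eventuallyEq (.of_forall fun y => ?_)
      simp [hF, real_inner_comm]
    simp only [fieldDiv, h1.fderiv]
    simp [PiLp.inner_apply, Fin.sum_univ_three]
    ring
  have hFC : ContDiff ℝ 1 F :=
    ((contDiff_id.inner ℝ contDiff_const).smul contDiff_const).sub (contDiff_id.const_smul _)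
  have h := integral_sphere_inner_eq_zero (R := 2) (ρ := 1) (F := F)
    hFC.contDiffOn (fun x _ => hdiv x) one_pos one_lt_two
  have h3 : ∀ ω : sphere (0 : E3) 1, inner ℝ (ω : E3) (F ((1 : ℝ) • (ω : E3))) =
      inner ℝ (ω : E3) u * inner ℝ (ω : E3) v - inner ℝ u v / 3 := by
    intro ω
    simp [hF, inner_sub_right, inner_smul_right]
  simp only [h3] at h
  rw [integral_sub (integrable_sphere_of_continuous (by fun_prop)) (integrable_const _)] at h
  simp only [integral_const, toSphere_real_univ, smul_eq_mul] at h
  linarith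

/-- Green's second identity for f and the linear function x·v: the field (x·v)G - f v is
divergence-free, and its zero flux reads ρ M'(ρ) = M(ρ). So M is linear in the radius, with slope
M'(0) given by the second moments of the sphere. -/
theorem integral_sphere_inner_mul_eq {R s : ℝ} {f : E3 → ℝ} {G : E3 → E3}
    (hfG : ∀ x ∈ ball (0 : E3) R, HasGradientAt f (G x) x) (hf : ContDiffOn ℝ 1 f (ball 0 R))
    (hG : ContDiffOn ℝ 1 G (ball 0 R)) (hdiv : ∀ x ∈ ball (0 : E3) R, fieldDiv G x = 0)
    (hs : 0 ≤ s) (hsR : s < R) (v : E3) :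
    ∫ ω : sphere (0 : E3) 1, inner ℝ (ω : E3) v * f (s • (ω : E3))
      ∂(volume : Measure E3).toSphere = 4 * Real.pi / 3 * s * inner ℝ (G 0) v := by
  set M : ℝ → ℝ := fun s => ∫ ω : sphere (0 : E3) 1, inner ℝ (ω : E3) v * f (s • (ω : E3))
    ∂(volume : Measure E3).toSphere with hM
  set M' : ℝ → ℝ := fun ρ => ∫ ω : sphere (0 : E3) 1,
    inner ℝ (ω : E3) v * inner ℝ (ω : E3) (G (ρ • (ω : E3)))
    ∂(volume : Measure E3).toSphere with hM'
  have hd : ∀ ρ, |ρ| < R → HasDerivAt M (M' ρ) ρ := fun ρ hρ =>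
    hasDerivAt_integral_sphere hfG hG.continuousOn (by fun_prop) hρ
  have hR : 0 < R := hs.trans_lt hsR
  have h0 : M 0 = 0 := by
    have : ∫ ω : sphere (0 : E3) 1, inner ℝ (ω : E3) v
        ∂(volume : Measure E3).toSphere = 0 :=
      integral_sphere_inner_eq_zero (R := 2) (ρ := 1) (F := fun _ => v) contDiffOn_const
        (by simp [fieldDiv]) one_pos one_lt_two
    simp [hM, integral_mul_const, this]
  have h0' : M' 0 = 4 * Real.pi / 3 * inner ℝ (G 0) v := by
    simp only [hM', zero_smul]
    rw [integral_sphere_inner_mul_inner, real_inner_comm]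
  set F : E3 → E3 := fun x => inner ℝ x v • G x - f x • v with hF
  have hFC : ContDiffOn ℝ 1 F (ball 0 R) :=
    ((contDiff_id.inner ℝ contDiff_const).contDiffOn.smul hG).sub (hf.smul contDiffOn_const)
  have hFdiv : ∀ x ∈ ball (0 : E3) R, fieldDiv F x = 0 := by
    intro x hx
    have hGx : DifferentiableAt ℝ G x :=
      ((hG x hx).contDiffAt (isOpen_ball.mem_nhds hx)).differentiableAt one_ne_zero
    have h2 := (((innerSL ℝ v).hasFDerivAt (x := x)).smul hGx.hasFDerivAt).sub
      ((hfG x hx).hasFDerivAt.smul_const v)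
    have h1 : HasFDerivAt F _ x := h2.congr_of_eventuallyEq (.of_forall fun y => by
      simp [hF, real_inner_comm])
    have h3 := hdiv x hx
    simp only [fieldDiv] at h3
    simp only [fieldDiv, h1.fderiv]
    -- Product rule, coordinate by coordinate: the terms v·G and G·v cancel and only (x·v) div G is
    -- left.
    have h4 : ∀ i, ((innerSL ℝ v x • fderiv ℝ G x + ((innerSL ℝ v).smulRight (G x)) -
        (InnerProductSpace.toDual ℝ E3 (G x)).smulRight v) (EuclideanSpace.single i 1)) i =
        inner ℝ v x * (fderiv ℝ G x (EuclideanSpace.single i 1)) i +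
          (v i * G x i - G x i * v i) := by
      intro i
      have h5 : ∀ u : E3, inner ℝ u (EuclideanSpace.single i (1 : ℝ)) = u i := fun u => by
        rw [EuclideanSpace.inner_single_right]; simp
      simp [h5]
      ring
    rw [Finset.sum_congr rfl fun i _ => h4 i, Finset.sum_add_distrib, ← Finset.mul_sum, h3]
    simp [mul_comm]
  have hode : ∀ ρ, 0 < ρ → ρ < R → ρ * M' ρ = M ρ := by
    intro ρ hρ hρR
    have h := integral_sphere_inner_eq_zero hFC hFdiv hρ hρR
    have habs : |ρ| < R := by rwa [abs_of_pos hρ]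
    have hGc := continuous_comp_smul_sphere hG.continuousOn habs
    have hfc := continuous_comp_smul_sphere hf.continuousOn habs
    have h3 : ∀ ω : sphere (0 : E3) 1, inner ℝ (ω : E3) (F (ρ • (ω : E3))) =
        ρ * (inner ℝ (ω : E3) v * inner ℝ (ω : E3) (G (ρ • (ω : E3)))) -
          inner ℝ (ω : E3) v * f (ρ • (ω : E3)) := by
      intro ω
      simp [hF, inner_sub_right, inner_smul_right, inner_smul_left]
      ring
    simp only [h3] at h
    have hv : Continuous fun ω : sphere (0 : E3) 1 => inner ℝ (ω : E3) v := by fun_prop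
    have hc1 : Continuous fun ω : sphere (0 : E3) 1 =>
        ρ * (inner ℝ (ω : E3) v * inner ℝ (ω : E3) (G (ρ • (ω : E3)))) :=
      continuous_const.mul (hv.mul (continuous_subtype_val.inner hGc))
    have hc2 : Continuous fun ω : sphere (0 : E3) 1 => inner ℝ (ω : E3) v * f (ρ • (ω : E3)) :=
      hv.mul hfc
    rw [integral_sub (integrable_sphere_of_continuous hc1)
      (integrable_sphere_of_continuous hc2), integral_const_mul] at h
    simp only [hM, hM']
    linarith
  rcases hs.eq_or_lt with rfl | hspos
  · rw [mul_zero, zero_mul]; exact h0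
  have hq : ∀ t ∈ Set.Ioo 0 R, M t / t = M s / s := by
    have hder : ∀ t ∈ Set.Ioo 0 R, HasDerivAt (fun t => M t / t) 0 t := by
      intro t ht
      have h := (hd t (by rw [abs_of_pos ht.1]; exact ht.2)).div (hasDerivAt_id t) ht.1.ne'
      have h0 : (M' t * id t - M t * 1) / id t ^ 2 = 0 := by
        rw [← hode t ht.1 ht.2, id, mul_one, mul_comm t, sub_self, zero_div]
      rw [h0] at h
      exact h
    intro t ht
    exact isOpen_Ioo.is_const_of_deriv_eq_zero isPreconnected_Ioo
      (fun t ht => (hder t ht).differentiableAt.differentiableWithinAt)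
      (fun t ht => (hder t ht).deriv) ht ⟨hspos, hsR⟩
  -- As M(0) = 0, the constant value of M(t)/t is the derivative at 0.
  have hlim : Filter.Tendsto (fun t => M t / t) (nhdsWithin 0 (Set.Ioi 0)) (nhds (M' 0)) := by
    have h := (hd 0 (by simpa using hR)).tendsto_slope_zero_right
    refine h.congr fun t => ?_
    simp [h0]; ring
  have hlim' : Filter.Tendsto (fun t => M t / t) (nhdsWithin 0 (Set.Ioi 0)) (nhds (M s / s)) := by
    refine tendsto_const_nhds.congr' ?_
    filter_upwards [Ioo_mem_nhdsGT hR] with t ht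
    exact (hq t ht).symm
  have := tendsto_nhds_unique hlim hlim'
  rw [h0', eq_div_iff hspos.ne'] at this
  refine this.symm.trans ?_
  ring

/-! ### The Newtonian kernel is harmonic away from its pole. -/

theorem hasFDerivAt_norm_of_ne {z : E3} (hz : z ≠ 0) :
    HasFDerivAt (fun z : E3 => ‖z‖) (‖z‖⁻¹ • innerSL ℝ z) z := by
  have h1 : HasFDerivAt (fun y : E3 => ‖y‖ ^ 2) (2 • innerSL ℝ z) z :=
    (hasStrictFDerivAt_norm_sq z).hasFDerivAt
  have hz' : ‖z‖ ≠ 0 := norm_ne_zero_iff.2 hz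
  have h2 := h1.sqrt (pow_ne_zero 2 hz')
  simp only [Real.sqrt_sq (norm_nonneg _)] at h2
  refine h2.congr_fderiv ?_
  ext v
  simp
  field_simp

/-- The gradient of the Newtonian kernel `x ↦ 1 / ‖x - y‖`. -/
noncomputable def newtonGrad (y x : E3) : E3 := -(‖x - y‖⁻¹ ^ 3) • (x - y)

theorem hasGradientAt_inv_norm_sub {x y : E3} (h : x ≠ y) :
    HasGradientAt (fun x : E3 => ‖x - y‖⁻¹) (newtonGrad y x) x := by
  have hz : x - y ≠ 0 := sub_ne_zero.2 h
  have hz' : ‖x - y‖ ≠ 0 := norm_ne_zero_iff.2 hz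
  have h1 := (hasFDerivAt_norm_of_ne hz).comp x ((hasFDerivAt_id (𝕜 := ℝ) x).sub_const y)
  have h2 := (hasDerivAt_inv hz').comp_hasFDerivAt x h1
  rw [hasGradientAt_iff_hasFDerivAt]
  refine HasFDerivAt.congr_fderiv (f := fun x : E3 => ‖x - y‖⁻¹) h2 ?_
  ext v
  simp [newtonGrad, -inv_pow]
  rw [show (‖x - y‖ ^ 2)⁻¹ = ‖x - y‖⁻¹ ^ 2 by simp]
  ring

theorem fieldDiv_newtonGrad {x y : E3} (h : x ≠ y) : fieldDiv (newtonGrad y) x = 0 := by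
  have hz' : ‖x - y‖ ≠ 0 := norm_ne_zero_iff.2 (sub_ne_zero.2 h)
  have h1 := (hasGradientAt_inv_norm_sub h).hasFDerivAt
  have h2 := ((h1.pow 3).neg).smul ((hasFDerivAt_id (𝕜 := ℝ) x).sub_const y)
  have h3 : HasFDerivAt (newtonGrad y) _ x := h2
  simp only [fieldDiv, h3.fderiv]
  have h5 : ∀ (u : E3) i, inner ℝ u (EuclideanSpace.single i (1 : ℝ)) = u i := fun u i => by
    rw [EuclideanSpace.inner_single_right]; simp
  have h6 : ‖x - y‖ ^ 2 = ∑ i, (x i - y i) ^ 2 := by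
    simp [EuclideanSpace.norm_sq_eq]
  -- With z = x - y the divergence is -3|z|⁻³ + 3|z|⁻⁵|z|²; in dimension 3 the terms cancel.
  have h7 : ‖x - y‖⁻¹ ^ 5 * ‖x - y‖ ^ 2 = ‖x - y‖⁻¹ ^ 3 := by field_simp
  rw [h6, Fin.sum_univ_three] at h7
  simp [h5, Fin.sum_univ_three, newtonGrad, -inv_pow]
  linear_combination 3 * h7

theorem contDiffAt_newtonGrad {x y : E3} (h : x ≠ y) : ContDiffAt ℝ 1 (newtonGrad y) x := by
  have hz : x - y ≠ 0 := sub_ne_zero.2 h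
  have h0 : ContDiffAt ℝ 1 (fun x : E3 => x - y) x := by fun_prop
  exact (((h0.norm ℝ hz).inv (norm_ne_zero_iff.2 hz)).pow 3).neg.smul h0

theorem contDiffAt_inv_norm_sub {x y : E3} (h : x ≠ y) :
    ContDiffAt ℝ 1 (fun x : E3 => ‖x - y‖⁻¹) x := by
  have hz : x - y ≠ 0 := sub_ne_zero.2 h
  have h0 : ContDiffAt ℝ 1 (fun x : E3 => x - y) x := by fun_prop
  exact (h0.norm ℝ hz).inv (norm_ne_zero_iff.2 hz)

/-! ### Moments of the kernel with its pole on the unit sphere. -/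

theorem ne_of_mem_ball_one {x y : E3} (hy : ‖y‖ = 1) (hx : x ∈ ball (0 : E3) 1) : x ≠ y := by
  rintro rfl
  simp [hy] at hx

theorem integral_sphere_inv_norm_smul_sub {y : E3} (hy : ‖y‖ = 1) {s : ℝ} (hs : 0 ≤ s)
    (hs1 : s < 1) :
    ∫ ω : sphere (0 : E3) 1, ‖s • (ω : E3) - y‖⁻¹ ∂(volume : Measure E3).toSphere
      = 4 * Real.pi := by
  have := integral_sphere_eq (fun x hx => hasGradientAt_inv_norm_sub (ne_of_mem_ball_one hy hx))
    (fun x hx => (contDiffAt_newtonGrad (ne_of_mem_ball_one hy hx)).contDiffWithinAt)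
    (fun x hx => fieldDiv_newtonGrad (ne_of_mem_ball_one hy hx)) hs hs1
  simpa [hy] using this

theorem integral_sphere_inner_mul_inv_norm_smul_sub {y : E3} (hy : ‖y‖ = 1) {s : ℝ} (hs : 0 ≤ s)
    (hs1 : s < 1) (v : E3) :
    ∫ ω : sphere (0 : E3) 1, inner ℝ (ω : E3) v * ‖s • (ω : E3) - y‖⁻¹
      ∂(volume : Measure E3).toSphere = 4 * Real.pi / 3 * s * inner ℝ y v := by
  have := integral_sphere_inner_mul_eq
    (fun x hx => hasGradientAt_inv_norm_sub (ne_of_mem_ball_one hy hx))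
    (fun x hx => (contDiffAt_inv_norm_sub (ne_of_mem_ball_one hy hx)).contDiffWithinAt)
    (fun x hx => (contDiffAt_newtonGrad (ne_of_mem_ball_one hy hx)).contDiffWithinAt)
    (fun x hx => fieldDiv_newtonGrad (ne_of_mem_ball_one hy hx)) hs hs1 v
  rw [this]
  simp [newtonGrad, hy]

theorem exists_seq_tendsto_one : ∃ s : ℕ → ℝ, (∀ n, 0 ≤ s n ∧ s n < 1) ∧
    Filter.Tendsto s Filter.atTop (nhds 1) := by
  obtain ⟨s, -, hs, hlim⟩ := exists_seq_strictMono_tendsto' (zero_lt_one (α := ℝ))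
  exact ⟨s, fun n => ⟨(hs n).1.le, (hs n).2⟩, hlim⟩

/-- Fatou along radii increasing to 1, where the integrals all equal 4π. The inverse is taken in
`ENNReal`, so it is infinite at the pole: finiteness of the integral then shows both that the pole
is a null set and that the real kernel is integrable. -/
theorem lintegral_sphere_inv_norm_sub_le {y : E3} (hy : ‖y‖ = 1) :
    ∫⁻ ω : sphere (0 : E3) 1, (ENNReal.ofReal ‖(ω : E3) - y‖)⁻¹
      ∂(volume : Measure E3).toSphere ≤ ENNReal.ofReal (4 * Real.pi) := by
  obtain ⟨s, hs, hlim⟩ := exists_seq_tendsto_one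
  have hne : ∀ n (ω : sphere (0 : E3) 1), 0 < ‖s n • (ω : E3) - y‖ := fun n ω =>
    norm_pos_iff.2 (sub_ne_zero.2 (ne_of_mem_ball_one hy (smul_sphere_mem_ball
      (by rw [abs_of_nonneg (hs n).1]; exact (hs n).2) ω)))
  have heq : ∀ n, ∫⁻ ω : sphere (0 : E3) 1, (ENNReal.ofReal ‖s n • (ω : E3) - y‖)⁻¹
      ∂(volume : Measure E3).toSphere = ENNReal.ofReal (4 * Real.pi) := by
    intro n
    have hc : Continuous fun ω : sphere (0 : E3) 1 => ‖s n • (ω : E3) - y‖⁻¹ :=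
      Continuous.inv₀ (by fun_prop) fun ω => (hne n ω).ne'
    rw [← integral_sphere_inv_norm_smul_sub hy (hs n).1 (hs n).2,
      ofReal_integral_eq_lintegral_ofReal (integrable_sphere_of_continuous hc)
        (.of_forall fun ω => by positivity)]
    exact lintegral_congr fun ω => (ENNReal.ofReal_inv_of_pos (hne n ω)).symm
  have hpt : ∀ ω : sphere (0 : E3) 1, Filter.liminf
      (fun n => (ENNReal.ofReal ‖s n • (ω : E3) - y‖)⁻¹) Filter.atTop =
      (ENNReal.ofReal ‖(ω : E3) - y‖)⁻¹ := by
    intro ω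
    refine Filter.Tendsto.liminf_eq ?_
    have h1 : Filter.Tendsto (fun n => ‖s n • (ω : E3) - y‖) Filter.atTop
        (nhds ‖(ω : E3) - y‖) := by
      simpa using ((hlim.smul_const (ω : E3)).sub_const y).norm
    exact tendsto_inv_iff.2 (ENNReal.tendsto_ofReal h1)
  calc
    _ = ∫⁻ ω : sphere (0 : E3) 1, Filter.liminf
          (fun n => (ENNReal.ofReal ‖s n • (ω : E3) - y‖)⁻¹) Filter.atTop
          ∂(volume : Measure E3).toSphere := lintegral_congr fun ω => (hpt ω).symm
    _ ≤ Filter.liminf (fun n => ∫⁻ ω : sphere (0 : E3) 1,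
          (ENNReal.ofReal ‖s n • (ω : E3) - y‖)⁻¹ ∂(volume : Measure E3).toSphere)
          Filter.atTop := lintegral_liminf_le fun n => by fun_prop
    _ = _ := by simp only [heq, Filter.liminf_const]

theorem ae_sphere_ne {y : E3} (hy : ‖y‖ = 1) :
    ∀ᵐ ω : sphere (0 : E3) 1 ∂(volume : Measure E3).toSphere, (ω : E3) ≠ y := by
  have := ae_lt_top (by fun_prop)
    ((lintegral_sphere_inv_norm_sub_le hy).trans_lt ENNReal.ofReal_lt_top).ne
  filter_upwards [this] with ω hω h
  simp [h] at hω

theorem integrable_sphere_inv_norm_sub {y : E3} (hy : ‖y‖ = 1) :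
    Integrable (fun ω : sphere (0 : E3) 1 => ‖(ω : E3) - y‖⁻¹)
      (volume : Measure E3).toSphere := by
  refine ⟨by fun_prop, ?_⟩
  refine lt_of_le_of_lt (lintegral_mono_ae ?_)
    ((lintegral_sphere_inv_norm_sub_le hy).trans_lt ENNReal.ofReal_lt_top)
  filter_upwards [ae_sphere_ne hy] with ω hω
  rw [← ENNReal.ofReal_inv_of_pos (norm_pos_iff.2 (sub_ne_zero.2 hω)),
    Real.enorm_of_nonneg (by positivity)]

/-- Dominated convergence, with a multiple of the boundary kernel as majorant: |ω - y| ≤ 2|sω - y|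
for unit vectors ω, y and 0 ≤ s < 1. -/
theorem tendsto_integral_sphere_mul_inv_norm {y : E3} (hy : ‖y‖ = 1) {w : sphere (0 : E3) 1 → ℝ}
    (hw : Continuous w) {s : ℕ → ℝ} (hs : ∀ n, 0 ≤ s n ∧ s n < 1)
    (hlim : Filter.Tendsto s Filter.atTop (nhds 1)) :
    Filter.Tendsto (fun n => ∫ ω : sphere (0 : E3) 1, w ω * ‖s n • (ω : E3) - y‖⁻¹
      ∂(volume : Measure E3).toSphere) Filter.atTop
      (nhds (∫ ω : sphere (0 : E3) 1, w ω * ‖(ω : E3) - y‖⁻¹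
        ∂(volume : Measure E3).toSphere)) := by
  obtain ⟨C, hC⟩ := isCompact_univ.exists_bound_of_continuousOn hw.continuousOn
  refine tendsto_integral_of_dominated_convergence
    (fun ω : sphere (0 : E3) 1 => C * (2 * ‖(ω : E3) - y‖⁻¹)) ?_ ?_ ?_ ?_
  · intro n
    have := hw.measurable
    exact Measurable.aestronglyMeasurable (by fun_prop)
  · exact ((integrable_sphere_inv_norm_sub hy).const_mul 2).const_mul C
  · intro n
    filter_upwards [ae_sphere_ne hy] with ω hω
    have hpos : 0 < ‖(ω : E3) - y‖ := norm_pos_iff.2 (sub_ne_zero.2 hω)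
    have hω1 : ‖(ω : E3)‖ = 1 := by simp
    have h1 : ‖(ω : E3) - y‖ ≤ 2 * ‖s n • (ω : E3) - y‖ := by
      have h2 : ‖(ω : E3) - s n • (ω : E3)‖ = 1 - s n := by
        rw [show (ω : E3) - s n • (ω : E3) = (1 - s n) • (ω : E3) by module, norm_smul, hω1,
          Real.norm_of_nonneg (by linarith [(hs n).2]), mul_one]
      -- The distance 1 - s from sω to ω is also its distance to the sphere, so it is at most |sω -
      -- y|.
      have h3 : 1 - s n ≤ ‖s n • (ω : E3) - y‖ := by
        have := norm_sub_norm_le y (s n • (ω : E3))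
        rw [norm_sub_rev, hy, norm_smul, hω1, Real.norm_of_nonneg (hs n).1, mul_one] at this
        exact this
      have := norm_sub_le_norm_sub_add_norm_sub (ω : E3) (s n • (ω : E3)) y
      linarith
    rw [norm_mul, norm_inv, norm_norm]
    have hC0 := (norm_nonneg _).trans (hC ω trivial)
    refine mul_le_mul (hC ω trivial) ?_ (by positivity) hC0
    have := inv_anti₀ hpos h1
    rw [mul_inv] at this
    linarith
  · filter_upwards [ae_sphere_ne hy] with ω hω
    have h1 : Filter.Tendsto (fun n => ‖s n • (ω : E3) - y‖) Filter.atTop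
        (nhds ‖(ω : E3) - y‖) := by
      simpa using ((hlim.smul_const (ω : E3)).sub_const y).norm
    exact (h1.inv₀ (norm_ne_zero_iff.2 (sub_ne_zero.2 hω))).const_mul _

theorem integral_sphere_inv_norm_sub {y : E3} (hy : ‖y‖ = 1) :
    ∫ ω : sphere (0 : E3) 1, ‖(ω : E3) - y‖⁻¹ ∂(volume : Measure E3).toSphere
      = 4 * Real.pi := by
  obtain ⟨s, hs, hlim⟩ := exists_seq_tendsto_one
  have h := tendsto_integral_sphere_mul_inv_norm hy (w := fun _ => 1) continuous_const hs hlim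
  simp only [one_mul, fun n => integral_sphere_inv_norm_smul_sub hy (hs n).1 (hs n).2] at h
  exact (tendsto_nhds_unique h tendsto_const_nhds)

theorem integral_sphere_inner_mul_inv_norm_sub {y : E3} (hy : ‖y‖ = 1) (v : E3) :
    ∫ ω : sphere (0 : E3) 1, inner ℝ (ω : E3) v * ‖(ω : E3) - y‖⁻¹
      ∂(volume : Measure E3).toSphere = 4 * Real.pi / 3 * inner ℝ y v := by
  obtain ⟨s, hs, hlim⟩ := exists_seq_tendsto_one
  have h := tendsto_integral_sphere_mul_inv_norm hy
    (w := fun ω : sphere (0 : E3) 1 => inner ℝ (ω : E3) v) (by fun_prop) hs hlim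
  simp only [fun n => integral_sphere_inner_mul_inv_norm_smul_sub hy (hs n).1 (hs n).2 v] at h
  refine tendsto_nhds_unique h ?_
  simpa using (hlim.const_mul (4 * Real.pi / 3)).mul_const (inner ℝ y v)

/-! ### The potential of the surface charge, on the sphere and near the centre. -/

/-- Fubini for the potential of a charged unit sphere, tested against a continuous weight. -/
theorem integral_sphere_mul_potential {τ w : sphere (0 : E3) 1 → ℝ}
    (hτ : Integrable τ (volume : Measure E3).toSphere) (hw : Continuous w) :
    ∫ ω, w ω * ∫ y : sphere (0 : E3) 1, τ y * ‖(ω : E3) - y‖⁻¹ ∂(volume : Measure E3).toSphere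
        ∂(volume : Measure E3).toSphere =
      ∫ y, τ y * ∫ ω : sphere (0 : E3) 1, w ω * ‖(ω : E3) - y‖⁻¹ ∂(volume : Measure E3).toSphere
        ∂(volume : Measure E3).toSphere := by
  obtain ⟨C, hC⟩ := isCompact_univ.exists_bound_of_continuousOn hw.continuousOn
  have hw' := hw.measurable
  have hk : ∀ y : sphere (0 : E3) 1, Integrable (fun ω : sphere (0 : E3) 1 => ‖(ω : E3) - y‖⁻¹)
      (volume : Measure E3).toSphere := fun y => integrable_sphere_inv_norm_sub (by simp)
  have hmeas : AEStronglyMeasurable (fun p : sphere (0 : E3) 1 × sphere (0 : E3) 1 =>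
      τ p.1 * ‖(p.2 : E3) - p.1‖⁻¹)
      ((volume : Measure E3).toSphere.prod (volume : Measure E3).toSphere) :=
    hτ.aestronglyMeasurable.comp_fst.mul (Measurable.aestronglyMeasurable (by fun_prop))
  have hint : Integrable (fun p : sphere (0 : E3) 1 × sphere (0 : E3) 1 =>
      τ p.1 * ‖(p.2 : E3) - p.1‖⁻¹)
      ((volume : Measure E3).toSphere.prod (volume : Measure E3).toSphere) := by
    -- Integrating the kernel first gives 4π for every y, so integrability of `τ` alone suffices.
    rw [integrable_prod_iff hmeas]
    refine ⟨.of_forall fun y => (hk y).const_mul (τ y), ?_⟩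
    have : ∀ y : sphere (0 : E3) 1, ∫ ω : sphere (0 : E3) 1, ‖τ y * ‖(ω : E3) - y‖⁻¹‖
        ∂(volume : Measure E3).toSphere = ‖τ y‖ * (4 * Real.pi) := by
      intro y
      simp only [norm_mul, norm_inv, norm_norm]
      rw [integral_const_mul, integral_sphere_inv_norm_sub (by simp)]
    simp only [this]
    exact hτ.norm.mul_const _
  have hint' : Integrable (fun p : sphere (0 : E3) 1 × sphere (0 : E3) 1 =>
      w p.2 * (τ p.1 * ‖(p.2 : E3) - p.1‖⁻¹))
      ((volume : Measure E3).toSphere.prod (volume : Measure E3).toSphere) :=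
    hint.bdd_mul (c := C) (Measurable.aestronglyMeasurable (by fun_prop))
      (.of_forall fun p => hC p.2 trivial)
  have h := integral_integral_swap (f := fun y ω : sphere (0 : E3) 1 =>
    w ω * (τ y * ‖(ω : E3) - y‖⁻¹)) hint'
  simp only [integral_const_mul] at h
  rw [← h]
  refine integral_congr_ae (.of_forall fun y => ?_)
  simp only
  rw [← integral_const_mul]
  refine integral_congr_ae (.of_forall fun ω => ?_)
  simp only
  ring

theorem sphereIntegral_eq {V : Type*} [NormedAddCommGroup V] [NormedSpace ℝ V] (c : E3) (r : ℝ)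
    (f : E3 → V) : sphereIntegral c r f =
      r ^ 2 • ∫ ω : sphere (0 : E3) 1, f (c + r • (ω : E3)) ∂(volume : Measure E3).toSphere := rfl

theorem surfacePotential_add_eq (ε₀ : ℝ) (c : E3) (r : ℝ) (σ : E3 → ℝ) (x : E3) :
    surfacePotential ε₀ c r σ (c + x) = 1 / (4 * Real.pi * ε₀) * (r ^ 2 *
      ∫ ω : sphere (0 : E3) 1, σ (c + r • (ω : E3)) * ‖x - r • (ω : E3)‖⁻¹
        ∂(volume : Measure E3).toSphere) := by
  simp [surfacePotential, sphereIntegral_eq, div_eq_mul_inv, add_sub_add_left_eq_sub]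

theorem surfacePotential_sphere_eq (ε₀ : ℝ) (c : E3) {r : ℝ} (hr : 0 < r) (σ : E3 → ℝ)
    (ω : sphere (0 : E3) 1) :
    surfacePotential ε₀ c r σ (c + r • (ω : E3)) = r / (4 * Real.pi * ε₀) *
      ∫ y : sphere (0 : E3) 1, σ (c + r • (y : E3)) * ‖(ω : E3) - y‖⁻¹
        ∂(volume : Measure E3).toSphere := by
  rw [surfacePotential_add_eq]
  have : ∀ y : sphere (0 : E3) 1, σ (c + r • (y : E3)) * ‖r • (ω : E3) - r • (y : E3)‖⁻¹ =
      r⁻¹ * (σ (c + r • (y : E3)) * ‖(ω : E3) - y‖⁻¹) := by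
    intro y
    rw [← smul_sub, norm_smul, Real.norm_of_nonneg hr.le, mul_inv]
    ring
  simp only [this]
  rw [integral_const_mul]
  field_simp

/-- Points near the centre stay at distance more than r/2 from the charges, so differentiation under
the integral is dominated by a multiple of |τ|. At the origin the kernel with pole rω has gradient
r⁻²ω. -/
theorem hasDerivAt_integral_mul_inv_norm {r : ℝ} (hr : 0 < r) {τ : sphere (0 : E3) 1 → ℝ}
    (hτ : Integrable τ (volume : Measure E3).toSphere) (v : E3) :
    HasDerivAt (fun s : ℝ => ∫ ω : sphere (0 : E3) 1, τ ω * ‖s • v - r • (ω : E3)‖⁻¹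
        ∂(volume : Measure E3).toSphere)
      (r⁻¹ ^ 2 * ∫ ω : sphere (0 : E3) 1, τ ω * inner ℝ (ω : E3) v
        ∂(volume : Measure E3).toSphere) 0 := by
  have hopen : IsOpen {s : ℝ | ‖s • v‖ < r / 2} := isOpen_lt (by fun_prop) continuous_const
  have hmem : (0 : ℝ) ∈ {s : ℝ | ‖s • v‖ < r / 2} := by simpa using hr
  have hfar : ∀ s ∈ {s : ℝ | ‖s • v‖ < r / 2}, ∀ ω : sphere (0 : E3) 1,
      r / 2 < ‖s • v - r • (ω : E3)‖ := by
    intro s hs ω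
    have hs' : ‖s • v‖ < r / 2 := hs
    have h1 := norm_sub_norm_le (r • (ω : E3)) (s • v)
    rw [norm_sub_rev (r • (ω : E3)), norm_smul r, Real.norm_of_nonneg hr.le,
      norm_eq_of_mem_sphere ω, mul_one] at h1
    linarith
  have hτm := hτ.aestronglyMeasurable
  have h := (hasDerivAt_integral_of_dominated_loc_of_deriv_le
    (μ := (volume : Measure E3).toSphere)
    (F := fun s (ω : sphere (0 : E3) 1) => τ ω * ‖s • v - r • (ω : E3)‖⁻¹)
    (bound := fun ω => ‖τ ω‖ * ((r / 2)⁻¹ ^ 2 * ‖v‖))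
    (F' := fun s (ω : sphere (0 : E3) 1) => τ ω * inner ℝ (newtonGrad (r • (ω : E3)) (s • v)) v)
    (x₀ := 0) (hopen.mem_nhds hmem) ?_ ?_ ?_ ?_ ?_ ?_).2
  · refine h.congr_deriv ?_
    rw [← integral_const_mul]
    refine integral_congr_ae (.of_forall fun ω => ?_)
    simp [newtonGrad, norm_smul, abs_of_pos hr, inner_smul_left, -inv_pow]
    field_simp
  · refine .of_forall fun s => hτm.mul (Measurable.aestronglyMeasurable (by fun_prop))
  · simp only [zero_smul, zero_sub, norm_neg, norm_smul, norm_eq_of_mem_sphere]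
    exact hτ.mul_const _
  · exact hτm.mul (Measurable.aestronglyMeasurable (by unfold newtonGrad; fun_prop))
  · refine .of_forall fun ω s hs => ?_
    have hf := hfar s hs ω
    have hpos : 0 < ‖s • v - r • (ω : E3)‖ := by linarith
    rw [norm_mul]
    gcongr
    refine (norm_inner_le_norm _ _).trans ?_
    gcongr
    have : ‖newtonGrad (r • (ω : E3)) (s • v)‖ = ‖s • v - r • (ω : E3)‖⁻¹ ^ 2 := by
      rw [newtonGrad, norm_smul, norm_neg, norm_pow, norm_inv, norm_norm]
      field_simp
    rw [this]
    gcongr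
  · exact hτ.norm.mul_const _
  · refine .of_forall fun ω s hs => ?_
    have hne : s • v ≠ r • (ω : E3) := by
      intro h
      have := hfar s hs ω
      rw [h, sub_self, norm_zero] at this
      linarith
    have h2 : HasDerivAt (fun s : ℝ => s • v) v s := by
      simpa using (hasDerivAt_id s).smul_const v
    have h3 := ((hasGradientAt_inv_norm_sub hne).hasFDerivAt.comp_hasDerivAt s h2).const_mul (τ ω)
    simpa using h3

/-! ### Harmonic functions continuous up to the sphere. -/

theorem contDiffAt_gradient {f : E3 → ℝ} {x : E3} (hf : ContDiffAt ℝ 2 f x) :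
    ContDiffAt ℝ 1 (gradient f) x :=
  (InnerProductSpace.toDual ℝ E3).symm.contDiff.contDiffAt.comp x
    (hf.fderiv_right (m := 1) (by norm_num))

theorem fieldDiv_gradient {f : E3 → ℝ} {x : E3} (hf : InnerProductSpace.HarmonicAt f x) :
    fieldDiv (gradient f) x = 0 := by
  have h0 : Laplacian.laplacian f x = 0 := hf.2.self_of_nhds
  rw [InnerProductSpace.laplacian_eq_iteratedFDeriv_orthonormalBasis f
    (EuclideanSpace.basisFun (Fin 3) ℝ)] at h0
  have hd : DifferentiableAt ℝ (fderiv ℝ f) x :=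
    (hf.1.fderiv_right (m := 1) (by norm_num)).differentiableAt one_ne_zero
  have hg : DifferentiableAt ℝ (gradient f) x :=
    (contDiffAt_gradient hf.1).differentiableAt one_ne_zero
  rw [fieldDiv, ← h0]
  refine Finset.sum_congr rfl fun i _ => ?_
  have h1 : HasFDerivAt (fun y => gradient f y i)
      ((EuclideanSpace.proj i).comp (fderiv ℝ (gradient f) x)) x :=
    (EuclideanSpace.proj (𝕜 := ℝ) i).hasFDerivAt.comp x hg.hasFDerivAt
  have h2 := hd.hasFDerivAt.clm_apply (hasFDerivAt_const (EuclideanSpace.single i (1 : ℝ)) x)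
  have h3 : (fun y => gradient f y i) = fun y => fderiv ℝ f y (EuclideanSpace.single i 1) := by
    ext y
    rw [← toDual_gradient, InnerProductSpace.toDual_apply_apply,
      EuclideanSpace.inner_single_right]
    simp
  rw [h3] at h1
  have h4 := congrArg (fun L => L (EuclideanSpace.single i (1 : ℝ))) (h1.unique h2)
  rw [iteratedFDeriv_two_apply]
  simpa using h4

/-- Carries the mean value identities from radii s < r to s = r, where `f` is only continuous. -/
theorem continuousOn_integral_sphere {r : ℝ} {c : E3} {f : E3 → ℝ}
    (hf : ContinuousOn f (closedBall c r)) {w : sphere (0 : E3) 1 → ℝ} (hw : Continuous w) :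
    ContinuousOn (fun s : ℝ => ∫ ω : sphere (0 : E3) 1, w ω * f (c + s • (ω : E3))
      ∂(volume : Measure E3).toSphere) (Set.Icc 0 r) := by
  refine continuousOn_integral_of_compact_support isCompact_univ ?_ (by simp)
  have h1 : ContinuousOn (fun p : ℝ × sphere (0 : E3) 1 => f (c + p.1 • (p.2 : E3)))
      (Set.Icc 0 r ×ˢ Set.univ) := by
    refine hf.comp (by fun_prop) ?_
    rintro ⟨s, ω⟩ ⟨hs, -⟩
    simp [norm_smul, abs_of_nonneg hs.1, hs.2]
  exact ContinuousOn.mul (by fun_prop) h1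

section Translate

variable {r : ℝ} {c : E3} {f : E3 → ℝ}

theorem hasGradientAt_add_left (hf : InnerProductSpace.HarmonicOnNhd f (ball c r)) :
    ∀ x ∈ ball (0 : E3) r, HasGradientAt (fun x => f (c + x)) (gradient f (c + x)) x := by
  intro x hx
  have hx' : c + x ∈ ball c r := by simpa using hx
  have h := ((hf _ hx').1.differentiableAt two_ne_zero).hasGradientAt.hasFDerivAt
  exact (hasFDerivAt_comp_add_left c).2 h

theorem integral_sphere_harmonic (hf : InnerProductSpace.HarmonicOnNhd f (ball c r))
    (hc : ContinuousOn f (closedBall c r)) (hr : 0 < r) :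
    ∫ ω : sphere (0 : E3) 1, f (c + r • (ω : E3)) ∂(volume : Measure E3).toSphere =
      4 * Real.pi * f c := by
  have hmem : ∀ x ∈ ball (0 : E3) r, c + x ∈ ball c r := fun x hx => by simpa using hx
  have hG : ContDiffOn ℝ 1 (fun x => gradient f (c + x)) (ball 0 r) := fun x hx =>
    ((contDiffAt_gradient (hf _ (hmem x hx)).1).comp x (by fun_prop)).contDiffWithinAt
  have hdiv : ∀ x ∈ ball (0 : E3) r, fieldDiv (fun x => gradient f (c + x)) x = 0 := by
    intro x hx
    rw [← fieldDiv_gradient (hf _ (hmem x hx))]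
    simp only [fieldDiv, fderiv_comp_add_left]
  have h1 := continuousOn_integral_sphere hc (w := fun _ => 1) continuous_const
  simp only [one_mul] at h1
  have h2 : Set.EqOn (fun s : ℝ => ∫ ω : sphere (0 : E3) 1, f (c + s • (ω : E3))
      ∂(volume : Measure E3).toSphere) (fun _ => 4 * Real.pi * f c) (Set.Ico 0 r) := by
    intro s hs
    have := integral_sphere_eq (hasGradientAt_add_left hf) hG hdiv hs.1 hs.2
    simpa using this
  exact h2.of_subset_closure h1 continuousOn_const Set.Ico_subset_Icc_self
    (by rw [closure_Ico hr.ne]) ⟨hr.le, le_rfl⟩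

theorem integral_sphere_inner_mul_harmonic (hf : InnerProductSpace.HarmonicOnNhd f (ball c r))
    (hc : ContinuousOn f (closedBall c r)) (hr : 0 < r) (v : E3) :
    ∫ ω : sphere (0 : E3) 1, inner ℝ (ω : E3) v * f (c + r • (ω : E3))
      ∂(volume : Measure E3).toSphere = 4 * Real.pi / 3 * r * inner ℝ (gradient f c) v := by
  have hmem : ∀ x ∈ ball (0 : E3) r, c + x ∈ ball c r := fun x hx => by simpa using hx
  have hG : ContDiffOn ℝ 1 (fun x => gradient f (c + x)) (ball 0 r) := fun x hx =>
    ((contDiffAt_gradient (hf _ (hmem x hx)).1).comp x (by fun_prop)).contDiffWithinAt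
  have hC : ContDiffOn ℝ 1 (fun x => f (c + x)) (ball 0 r) := fun x hx =>
    (((hf _ (hmem x hx)).1.of_le one_le_two).comp x (by fun_prop)).contDiffWithinAt
  have hdiv : ∀ x ∈ ball (0 : E3) r, fieldDiv (fun x => gradient f (c + x)) x = 0 := by
    intro x hx
    rw [← fieldDiv_gradient (hf _ (hmem x hx))]
    simp only [fieldDiv, fderiv_comp_add_left]
  have h1 := continuousOn_integral_sphere hc
    (w := fun ω : sphere (0 : E3) 1 => inner ℝ (ω : E3) v) (by fun_prop)
  have h2 : Set.EqOn (fun s : ℝ => ∫ ω : sphere (0 : E3) 1, inner ℝ (ω : E3) v *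
      f (c + s • (ω : E3)) ∂(volume : Measure E3).toSphere)
      (fun s => 4 * Real.pi / 3 * s * inner ℝ (gradient f c) v) (Set.Ico 0 r) := by
    intro s hs
    have := integral_sphere_inner_mul_eq (hasGradientAt_add_left hf) hC hG hdiv hs.1 hs.2 v
    simpa using this
  exact h2.of_subset_closure h1 (by fun_prop) Set.Ico_subset_Icc_self
    (by rw [closure_Ico hr.ne]) ⟨hr.le, le_rfl⟩

end Translate

theorem hasDerivAt_line_of_harmonicAt {f : E3 → ℝ} {c : E3}
    (hf : InnerProductSpace.HarmonicAt f c) (v : E3) :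
    HasDerivAt (fun s : ℝ => f (c + s • v)) (inner ℝ (gradient f c) v) 0 := by
  have h1 : HasFDerivAt f (InnerProductSpace.toDual ℝ E3 (gradient f c)) (c + (0 : ℝ) • v) := by
    simpa using (hf.1.differentiableAt two_ne_zero).hasGradientAt.hasFDerivAt
  have h2 : HasDerivAt (fun s : ℝ => c + s • v) v 0 := by
    simpa using ((hasDerivAt_id (0 : ℝ)).smul_const v).const_add c
  exact (h1.comp_hasDerivAt 0 h2).congr_deriv (by simp)

/-! ### Moments of the induced density, and the conclusion. -/

/-- The first two moments of an induced density over the unit sphere. -/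
theorem IsInducedDensity.moments {ε₀ r : ℝ} (hε₀ : 0 < ε₀) (hr : 0 < r) {c : E3}
    {φ₀ σ : E3 → ℝ} (hφ₀ : InnerProductSpace.HarmonicOnNhd φ₀ (ball c r))
    (hσ : IsInducedDensity ε₀ c r φ₀ σ) :
    r * ∫ ω : sphere (0 : E3) 1, σ (c + r • (ω : E3)) ∂(volume : Measure E3).toSphere =
        -(4 * Real.pi * ε₀ * φ₀ c) ∧
    ∀ v : E3, ∫ ω : sphere (0 : E3) 1, σ (c + r • (ω : E3)) * inner ℝ (ω : E3) v
        ∂(volume : Measure E3).toSphere = -(4 * Real.pi * ε₀ * inner ℝ (gradient φ₀ c) v) := by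
  have hπ := Real.pi_pos
  obtain ⟨hτ, hin | ⟨hcont, hsurf⟩⟩ := hσ
  · simp only [totalPotential] at hin
    constructor
    · have h := hin (c + 0) (by simpa using hr)
      rw [surfacePotential_add_eq] at h
      simp only [zero_sub, norm_neg, norm_smul, norm_eq_of_mem_sphere, add_zero,
        integral_mul_const, Real.norm_of_nonneg hr.le, mul_one] at h
      field_simp at h
      linarith
    · intro v
      have h1 := hasDerivAt_line_of_harmonicAt (hφ₀ c (mem_ball_self hr)) v
      have h2 := ((hasDerivAt_integral_mul_inv_norm hr hτ v).const_mul (r ^ 2)).const_mul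
        (1 / (4 * Real.pi * ε₀))
      have h3 := h1.add h2
      have hopen : IsOpen {s : ℝ | ‖s • v‖ < r} := isOpen_lt (by fun_prop) continuous_const
      -- The total potential vanishes along the line near the centre, so its two derivatives add up
      -- to 0.
      have h4 := h3.unique ((hasDerivAt_const (0 : ℝ) (0 : ℝ)).congr_of_eventuallyEq (by
        filter_upwards [hopen.mem_nhds (by simpa using hr)] with s hs
        have := hin (c + s • v) (by simpa using hs)
        rwa [surfacePotential_add_eq] at this))
      field_simp at h4
      linarith
  · simp only [totalPotential] at hsurf
    -- The boundary condition tested against a weight. For w = 1 and w = ω·v the inner integral is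
    -- 4π and (4π/3) y·v, which turns the right side into a moment of `σ`.
    have key : ∀ w : sphere (0 : E3) 1 → ℝ, Continuous w →
        ∫ ω : sphere (0 : E3) 1, w ω * φ₀ (c + r • (ω : E3)) ∂(volume : Measure E3).toSphere =
        -(r / (4 * Real.pi * ε₀)) * ∫ y : sphere (0 : E3) 1, σ (c + r • (y : E3)) *
          ∫ ω : sphere (0 : E3) 1, w ω * ‖(ω : E3) - y‖⁻¹ ∂(volume : Measure E3).toSphere
          ∂(volume : Measure E3).toSphere := by
      intro w hw
      rw [← integral_sphere_mul_potential hτ hw, ← integral_const_mul]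
      refine integral_congr_ae ?_
      filter_upwards [hsurf] with ω hω
      rw [surfacePotential_sphere_eq ε₀ c hr] at hω
      linear_combination w ω * hω
    constructor
    · have h := key (fun _ => 1) continuous_const
      simp only [one_mul, integral_sphere_harmonic hφ₀ hcont hr,
        fun y : sphere (0 : E3) 1 => integral_sphere_inv_norm_sub (norm_eq_of_mem_sphere y),
        integral_mul_const] at h
      field_simp at h
      linarith
    · intro v
      have h := key (fun ω => inner ℝ (ω : E3) v) (by fun_prop)
      simp only [integral_sphere_inner_mul_harmonic hφ₀ hcont hr v,
        fun y : sphere (0 : E3) 1 =>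
          integral_sphere_inner_mul_inv_norm_sub (norm_eq_of_mem_sphere y) v,
        mul_left_comm (σ _) (4 * Real.pi / 3), integral_const_mul] at h
      field_simp at h
      linarith

theorem inner_dipoleMoment {r : ℝ} {c : E3} {σ : E3 → ℝ}
    (hσ : Integrable (fun ω : sphere (0 : E3) 1 => σ (c + r • (ω : E3)))
      (volume : Measure E3).toSphere) (v : E3) :
    inner ℝ v (dipoleMoment c r σ) = r ^ 3 * ∫ ω : sphere (0 : E3) 1,
      σ (c + r • (ω : E3)) * inner ℝ (ω : E3) v ∂(volume : Measure E3).toSphere := by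
  have hint : Integrable (fun ω : sphere (0 : E3) 1 =>
      σ (c + r • (ω : E3)) • (c + r • (ω : E3) - c)) (volume : Measure E3).toSphere := by
    refine hσ.smul_bdd ‖r‖ (Continuous.aestronglyMeasurable (by fun_prop))
      (.of_forall fun ω => ?_)
    simp [norm_smul]
  rw [dipoleMoment, sphereIntegral_eq, inner_smul_right, ← integral_inner hint v,
    pow_succ r 2, mul_assoc, ← integral_const_mul r]
  congr 1
  refine integral_congr_ae (.of_forall fun ω => ?_)
  simp [inner_smul_right, real_inner_comm]
  ring

theorem corollary1 (ε₀ r : ℝ) (hε₀ : 0 < ε₀) (hr : 0 < r) (c : E3)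
    (φ₀ : E3 → ℝ) (hφ₀ : InnerProductSpace.HarmonicOnNhd φ₀ (Metric.ball c r))
    (σ : E3 → ℝ) (hσ : IsInducedDensity ε₀ c r φ₀ σ) :
    fullCharge c r σ = 4 * Real.pi * ε₀ * r * axisCoeff₁ φ₀ c ∧
    (∀ e : E3, ‖e‖ = 1 →
      inner ℝ e (dipoleMoment c r σ) = 4 * Real.pi * ε₀ * r ^ 3 * axisCoeff₂ φ₀ c e) ∧
    dipoleMoment c r σ = (4 * Real.pi * ε₀ * r ^ 3) • (-gradient φ₀ c) := by
  obtain ⟨h0, h1⟩ := hσ.moments hε₀ hr hφ₀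
  refine ⟨?_, fun e _ => ?_, ?_⟩
  · rw [fullCharge, sphereIntegral_eq, axisCoeff₁, smul_eq_mul]
    linear_combination r * h0
  · rw [inner_dipoleMoment hσ.1, h1, axisCoeff₂,
      (hasDerivAt_line_of_harmonicAt (hφ₀ c (mem_ball_self hr)) e).deriv]
    ring
  · refine ext_inner_left ℝ fun v => ?_
    rw [inner_dipoleMoment hσ.1, h1, inner_smul_right, inner_neg_right, real_inner_comm]
    ring
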